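/- Let $X$ be a complex Banach space, let $k\ge 1$ be an integer, $n=2k$, and let $K\subset\mathbb R^n$ be compact. Let $F:\mathbb R^n\to X$ be (Bochner) integrable and $k$-times continuously differentiable. For $R\ge 1$ and $x\in\mathbb R^n$ put $$\hat F(\xi)=\int_{\mathbb R^n}e^{-i\xi\cdot s}F(s)\,ds,\qquad S_R(F)(x)=\frac1{(2\pi)^n}\int_{|\xi|\le R}e^{ix\cdot \xi}\hat F(\xi)\,d\xi .$$ Assume that there are a real-valued $g\in L^1(\mathbb R^n)$ and $\delta>0$ such that $$\sup_{\alpha\in\mathbb N_0^n,\ |\alpha|\le k}\ \sup_{x\in K}\ |y|^{-n+k}\,\bigl\|\nabla^\alpha F(x+y)\bigr\|\le g(y)\qquad\text{for all } y\in\mathbb R^n \text{ with } |y|\ge\delta ,$$ where $\nabla^\alpha F=\partial_1^{\alpha_1}\cdots\partial_n^{\alpha_n}F$ and $|\cdot|$ is the Euclidean norm on $\mathbb R^n$. Then $S_R(F)\to F$ as $R\to\infty$ uniformly on $K$, that is, $$\lim_{R\to\infty}\ \sup_{x\in K}\ \|S_R(F)(x)-F(x)\|=0 .$$ -/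

import Mathlib

open MeasureTheory Filter

noncomputable section

variable {n : ℕ} {X : Type*} [NormedAddCommGroup X] [NormedSpace ℂ X]

/-- The Fourier transform `k ↦ ∫ e^{-i k·s} F(s) ds` on `ℝⁿ`, for vector-valued `F`
(angular frequency convention, without a normalising factor). -/
def angularFourier (F : EuclideanSpace ℝ (Fin n) → X) (k : EuclideanSpace ℝ (Fin n)) : X :=
  ∫ s, Complex.exp (-(Complex.I * ((inner ℝ k s : ℝ) : ℂ))) • F s

/-- The spherical partial Fourier inversion integral
`S_R(F)(x) = (2π)^{-n} ∫_{|k| ≤ R} e^{i x·k} F̂(k) dk`. -/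
def fourierPartialInversion (R : ℝ) (F : EuclideanSpace ℝ (Fin n) → X)
    (x : EuclideanSpace ℝ (Fin n)) : X :=
  ((1 : ℂ) / (2 * (Real.pi : ℂ)) ^ n) •
    ∫ k in Metric.closedBall (0 : EuclideanSpace ℝ (Fin n)) R,
      Complex.exp (Complex.I * ((inner ℝ x k : ℝ) : ℂ)) • angularFourier F k

/-- The partial derivative `∇^α F(x) = ∂₁^{α₁} ⋯ ∂ₙ^{αₙ} F(x)` for a multi-index `α`: the
derivative of order `|α| = α₁ + ⋯ + αₙ` of `F` at `x`, evaluated at the list of standard basis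
vectors in which `e₁` occurs `α₁` times, then `e₂` occurs `α₂` times, and so on. -/
def multiPartialDeriv (α : Fin n → ℕ) (F : EuclideanSpace ℝ (Fin n) → X)
    (x : EuclideanSpace ℝ (Fin n)) : X :=
  iteratedFDeriv ℝ (∑ i, α i) F x
    (fun j => EuclideanSpace.single (finSigmaFinEquiv.symm j).1 (1 : ℝ))

end

/-! Write P_m for `besselIntegral m`, a multiple of r^{-m} J_m(r). By Fubini, S_R F(x) = ∫ D_R(y)
F(x+y) dy, where D_R is the normalised Fourier transform of a ball. Since n = 2k is even, D_R(y) = c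
R^{2k} P_k(R|y|) with an integer index. In polar coordinates S_R F(x) becomes an integral over
directions ω of radial integrals of c R^{2k} r^{2k-1} P_k(Rr) v(r), with v(r) = F(x + rω).

Since P_m'(r) = -r P_{m+1}(r)/(2m+1), each integration by parts lowers the index by one, at the cost
of an Euler operator c + r d/dr on v. After k of them there remain π(2k-1)! v(0) and an error at
most C ∫ |P_0(Rr)| G(r) dr, where G dominates max(1, r^{k-1}) |v^{(j)}| for j ≤ k
(`besselRadialIntegral_succ`, `besselRadialIntegral_zero`, `exists_besselRadialIntegral_bound`).
Over the sphere the main terms add up to exactly F(x) (`dirichletConst_mul_eq_one`).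

The growth hypothesis supplies one integrable H on ℝⁿ that yields G for every x in K
(`exists_integrable_majorant`). P_0 is bounded by π and tends to 0 at infinity by Riemann–Lebesgue
(`tendsto_besselIntegral_zero`), so ∫ |P_0(R|y|)| H(y) dy → 0 by dominated convergence. This bound
does not involve x, hence the uniformity. -/

noncomputable section

/-! ### Bessel-type integrals: recurrences, decay, derivative. -/

/-- The Bessel-type integral `∫_0^π e^{i r cos θ} sin^{2m} θ dθ`, proportional to
`r^{-m} J_m(r)`. -/
def besselIntegral (m : ℕ) (r : ℝ) : ℂ :=
  ∫ θ in (0 : ℝ)..Real.pi, Complex.exp (Complex.I * (r * Real.cos θ : ℝ)) *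
    ((Real.sin θ ^ (2 * m) : ℝ) : ℂ)

/-- The companion integral `∫_0^π e^{i r cos θ} cos θ sin^{2m} θ dθ`. -/
def besselCosIntegral (m : ℕ) (r : ℝ) : ℂ :=
  ∫ θ in (0 : ℝ)..Real.pi, Complex.exp (Complex.I * (r * Real.cos θ : ℝ)) *
    ((Real.cos θ * Real.sin θ ^ (2 * m) : ℝ) : ℂ)

theorem norm_exp_I_mul_real (x : ℝ) : ‖Complex.exp (Complex.I * (x : ℂ))‖ = 1 := by
  rw [mul_comm]; exact Complex.norm_exp_ofReal_mul_I x

theorem norm_besselIntegral_le (m : ℕ) (r : ℝ) : ‖besselIntegral m r‖ ≤ Real.pi := by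
  have h := intervalIntegral.norm_integral_le_of_norm_le_const (a := 0) (b := Real.pi) (C := 1)
    (f := fun θ : ℝ => Complex.exp (Complex.I * (r * Real.cos θ : ℝ)) * ((Real.sin θ ^ (2 * m) : ℝ) : ℂ)) (by
      intro θ _
      rw [norm_mul, norm_exp_I_mul_real, Complex.norm_real, norm_pow, Real.norm_eq_abs, one_mul]
      exact pow_le_one₀ (abs_nonneg _) (Real.abs_sin_le_one θ))
  simpa [besselIntegral, abs_of_pos Real.pi_pos] using h

theorem norm_besselCosIntegral_le (m : ℕ) (r : ℝ) : ‖besselCosIntegral m r‖ ≤ Real.pi := by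
  have h := intervalIntegral.norm_integral_le_of_norm_le_const (a := 0) (b := Real.pi) (C := 1)
    (f := fun θ : ℝ => Complex.exp (Complex.I * (r * Real.cos θ : ℝ)) *
      ((Real.cos θ * Real.sin θ ^ (2 * m) : ℝ) : ℂ)) (by
      intro θ _
      rw [norm_mul, norm_exp_I_mul_real, Complex.norm_real, norm_mul, norm_pow,
        Real.norm_eq_abs, Real.norm_eq_abs, one_mul]
      exact mul_le_one₀ (Real.abs_cos_le_one θ) (by positivity)
        (pow_le_one₀ (abs_nonneg _) (Real.abs_sin_le_one θ)))
  simpa [besselCosIntegral, abs_of_pos Real.pi_pos] using h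

theorem hasDerivAt_exp_I_mul_cos (r θ : ℝ) :
    HasDerivAt (fun θ : ℝ => Complex.exp (Complex.I * (r * Real.cos θ : ℝ)))
      (-(Complex.I * r * Real.sin θ) * Complex.exp (Complex.I * (r * Real.cos θ : ℝ))) θ := by
  have h := ((((Real.hasDerivAt_cos θ).const_mul r).ofReal_comp).const_mul Complex.I).cexp
  convert h using 1
  push_cast; ring

/-- Integration by parts against `e^{i r cos θ}` for a real weight vanishing at the endpoints. -/
theorem integral_exp_I_mul_cos_mul_deriv {r : ℝ} {w w' : ℝ → ℝ} (hw : ∀ θ, HasDerivAt w (w' θ) θ)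
    (hw' : Continuous w') (h0 : w 0 = 0) (hπ : w Real.pi = 0) :
    ∫ θ in (0 : ℝ)..Real.pi, Complex.exp (Complex.I * (r * Real.cos θ : ℝ)) * ((w' θ : ℝ) : ℂ) =
      Complex.I * r * ∫ θ in (0 : ℝ)..Real.pi,
        Complex.exp (Complex.I * (r * Real.cos θ : ℝ)) * ((Real.sin θ * w θ : ℝ) : ℂ) := by
  have hwc : Continuous w := continuous_iff_continuousAt.2 fun θ => (hw θ).continuousAt
  rw [intervalIntegral.integral_mul_deriv_eq_deriv_mul (v := fun θ => ((w θ : ℝ) : ℂ))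
    (fun θ _ => hasDerivAt_exp_I_mul_cos r θ) (fun θ _ => (hw θ).ofReal_comp)
    (Continuous.intervalIntegrable (by fun_prop) _ _)
    (Continuous.intervalIntegrable (by fun_prop) _ _)]
  simp only [h0, hπ, Complex.ofReal_zero, mul_zero, sub_zero, zero_sub]
  rw [← intervalIntegral.integral_neg, ← intervalIntegral.integral_const_mul]
  congr 1 with θ
  push_cast; ring

theorem besselIntegral_succ (m : ℕ) (r : ℝ) :
    Complex.I * r * besselIntegral (m + 1) r = (2 * m + 1) * besselCosIntegral m r := by
  have h := integral_exp_I_mul_cos_mul_deriv (r := r) (w := fun θ => Real.sin θ ^ (2 * m + 1))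
    (w' := fun θ => (2 * m + 1) * (Real.cos θ * Real.sin θ ^ (2 * m))) (fun θ => by
      refine ((Real.hasDerivAt_sin θ).pow (2 * m + 1)).congr_deriv ?_
      rw [Nat.add_sub_cancel]
      push_cast
      ring) (by fun_prop) (by simp) (by simp)
  have e1 : besselIntegral (m + 1) r = ∫ θ in (0 : ℝ)..Real.pi,
        Complex.exp (Complex.I * (r * Real.cos θ : ℝ)) * ((Real.sin θ * Real.sin θ ^ (2 * m + 1) : ℝ) : ℂ) := by
    unfold besselIntegral
    congr 1 with θ
    push_cast; ring
  rw [e1, ← h, besselCosIntegral, ← intervalIntegral.integral_const_mul]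
  congr 1 with θ
  push_cast; ring

theorem besselCosIntegral_succ (m : ℕ) (r : ℝ) :
    Complex.I * r * besselCosIntegral (m + 1) r =
      (2 * m + 1) * besselIntegral m r - (2 * m + 2) * besselIntegral (m + 1) r := by
  have h := integral_exp_I_mul_cos_mul_deriv (r := r)
    (w := fun θ => Real.sin θ ^ (2 * m + 1) * Real.cos θ)
    (w' := fun θ => (2 * m + 1) * Real.sin θ ^ (2 * m) - (2 * m + 2) * Real.sin θ ^ (2 * (m + 1)))
    (fun θ => by
      refine (((Real.hasDerivAt_sin θ).pow (2 * m + 1)).mul (Real.hasDerivAt_cos θ)).congr_deriv ?_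
      have h2 : Real.cos θ * Real.cos θ = 1 - Real.sin θ ^ 2 := by
        rw [← sq, Real.cos_sq']
      rw [Nat.add_sub_cancel, Pi.pow_apply]
      push_cast
      linear_combination ((2 * (m : ℝ) + 1) * Real.sin θ ^ (2 * m)) * h2)
    (by fun_prop) (by simp) (by simp)
  have e1 : besselCosIntegral (m + 1) r = ∫ θ in (0 : ℝ)..Real.pi,
        Complex.exp (Complex.I * (r * Real.cos θ : ℝ)) *
          ((Real.sin θ * (Real.sin θ ^ (2 * m + 1) * Real.cos θ) : ℝ) : ℂ) := by
    unfold besselCosIntegral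
    congr 1 with θ
    push_cast; ring
  rw [e1, ← h, besselIntegral, besselIntegral, ← intervalIntegral.integral_const_mul,
    ← intervalIntegral.integral_const_mul, ← intervalIntegral.integral_sub
      (Continuous.intervalIntegrable (by fun_prop) _ _)
      (Continuous.intervalIntegrable (by fun_prop) _ _)]
  congr 1 with θ
  push_cast; ring

/-- The two recurrences each gain a factor 1/r. The rate r^{-m} is half a power short of the true
one, but it is all that integrability of the radial integrands needs. -/
theorem exists_besselIntegral_decay (m : ℕ) :
    ∃ C, ∀ r, 0 ≤ r → r ^ m * ‖besselIntegral m r‖ ≤ C ∧ r ^ m * ‖besselCosIntegral m r‖ ≤ C := by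
  induction m with
  | zero =>
    exact ⟨Real.pi, fun r _ => by simpa using ⟨norm_besselIntegral_le 0 r, norm_besselCosIntegral_le 0 r⟩⟩
  | succ m ih =>
    obtain ⟨C, hC⟩ := ih
    have hC0 : 0 ≤ C := by
      have := (hC 1 zero_le_one).1
      simp only [one_pow, one_mul] at this
      exact (norm_nonneg _).trans this
    have hP : ∀ r, 0 ≤ r → r ^ (m + 1) * ‖besselIntegral (m + 1) r‖ ≤ (2 * m + 1) * C := by
      intro r hr
      have h := congrArg norm (besselIntegral_succ m r)
      have h2 : ‖(2 * m + 1 : ℂ)‖ = 2 * m + 1 := by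
        rw [← Nat.cast_ofNat, ← Nat.cast_mul, ← Nat.cast_add_one, Complex.norm_natCast]
        push_cast; ring
      rw [norm_mul, norm_mul, norm_mul, Complex.norm_I, Complex.norm_real, Real.norm_of_nonneg hr,
        one_mul, h2] at h
      rw [pow_succ, mul_assoc, h, mul_left_comm]
      exact mul_le_mul_of_nonneg_left (hC r hr).2 (by positivity)
    refine ⟨Real.pi + (2 * m + 1) * C + (2 * m + 2) * ((2 * m + 1) * C), fun r hr => ⟨?_, ?_⟩⟩
    · have : 0 ≤ (2 * m + 2) * ((2 * m + 1) * C) := by positivity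
      linarith [hP r hr, Real.pi_pos]
    -- The recurrence brings in `besselIntegral (m + 1)` with weight r^m, which its bound with
    -- weight r^(m+1) controls only for r ≥ 1. Below 1 the trivial bound π suffices.
    · rcases le_total r 1 with h1 | h1
      · have h3 : r ^ (m + 1) * ‖besselCosIntegral (m + 1) r‖ ≤ 1 * Real.pi :=
          mul_le_mul (pow_le_one₀ hr h1) (norm_besselCosIntegral_le _ _) (norm_nonneg _) zero_le_one
        have : 0 ≤ (2 * m + 1) * C + (2 * m + 2) * ((2 * m + 1) * C) := by positivity
        linarith
      · have h := congrArg norm (besselCosIntegral_succ m r)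
        have h4 := norm_sub_le ((2 * m + 1) * besselIntegral m r) ((2 * m + 2) * besselIntegral (m + 1) r)
        have h2 : ‖(2 * m + 1 : ℂ)‖ = 2 * m + 1 := by
          rw [← Nat.cast_ofNat, ← Nat.cast_mul, ← Nat.cast_add_one, Complex.norm_natCast]
          push_cast; ring
        have h2' : ‖(2 * m + 2 : ℂ)‖ = 2 * m + 2 := by
          rw [← Nat.cast_ofNat, ← Nat.cast_mul, ← Nat.cast_add, Complex.norm_natCast]
          push_cast; ring
        rw [norm_mul, norm_mul, Complex.norm_I, Complex.norm_real, Real.norm_of_nonneg hr,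
          one_mul] at h
        rw [norm_mul, norm_mul, h2, h2', ← h] at h4
        have h5 : r ^ m * (r * ‖besselCosIntegral (m + 1) r‖) ≤
          (2 * m + 1) * (r ^ m * ‖besselIntegral m r‖) +
            (2 * m + 2) * (r ^ m * ‖besselIntegral (m + 1) r‖) := by
          refine (mul_le_mul_of_nonneg_left h4 (by positivity)).trans_eq (by ring)
        have h6 : r ^ m * ‖besselIntegral (m + 1) r‖ ≤ (2 * m + 1) * C :=
          (mul_le_mul_of_nonneg_right (pow_le_pow_right₀ h1 (Nat.le_succ m)) (norm_nonneg _)).trans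
            (hP r hr)
        have h7 : (2 * m + 1) * (r ^ m * ‖besselIntegral m r‖) ≤ (2 * m + 1) * C :=
          mul_le_mul_of_nonneg_left (hC r hr).1 (by positivity)
        have h8 : (2 * m + 2) * (r ^ m * ‖besselIntegral (m + 1) r‖) ≤
          (2 * m + 2) * ((2 * m + 1) * C) := mul_le_mul_of_nonneg_left h6 (by positivity)
        rw [pow_succ, mul_assoc]
        linarith [Real.pi_pos]

theorem besselIntegral_zero_right (m : ℕ) :
    besselIntegral m 0 = ((Real.pi * ∏ i ∈ Finset.range m, ((2 * i + 1 : ℝ) / (2 * i + 2)) : ℝ) : ℂ) := by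
  rw [← integral_sin_pow_even, ← intervalIntegral.integral_ofReal]
  simp [besselIntegral]

/-- Differentiating under the integral gives `I * besselCosIntegral m r`, which
`besselIntegral_succ` converts to index m + 1. This relation drives every later integration by
parts. -/
theorem hasDerivAt_besselIntegral (m : ℕ) (r : ℝ) :
    HasDerivAt (besselIntegral m) (-(r / (2 * m + 1) : ℝ) * besselIntegral (m + 1) r) r := by
  have h := intervalIntegral.hasDerivAt_integral_of_dominated_loc_of_deriv_le (μ := volume)
    (a := 0) (b := Real.pi) (x₀ := r) (s := Set.univ) (bound := fun _ => 1)
    (F := fun r θ : ℝ => Complex.exp (Complex.I * (r * Real.cos θ : ℝ)) * ((Real.sin θ ^ (2 * m) : ℝ) : ℂ))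
    (F' := fun r θ : ℝ => Complex.I * (Complex.exp (Complex.I * (r * Real.cos θ : ℝ)) *
      ((Real.cos θ * Real.sin θ ^ (2 * m) : ℝ) : ℂ))) Filter.univ_mem
    (Eventually.of_forall fun r => (Continuous.aestronglyMeasurable (by fun_prop)))
    (Continuous.intervalIntegrable (by fun_prop) _ _)
    (Continuous.aestronglyMeasurable (by fun_prop))
    (Eventually.of_forall fun θ _ r _ => by
      rw [norm_mul, norm_mul, norm_exp_I_mul_real, Complex.norm_I, Complex.norm_real, norm_mul,
        norm_pow, Real.norm_eq_abs, Real.norm_eq_abs, one_mul, one_mul]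
      exact mul_le_one₀ (Real.abs_cos_le_one θ) (by positivity)
        (pow_le_one₀ (abs_nonneg _) (Real.abs_sin_le_one θ)))
    (by simp)
    (Eventually.of_forall fun θ _ r _ => by
      have h := ((((hasDerivAt_id r).mul_const (Real.cos θ)).ofReal_comp).const_mul Complex.I).cexp.mul_const
        ((Real.sin θ ^ (2 * m) : ℝ) : ℂ)
      refine h.congr_deriv ?_
      simp only [id]
      push_cast
      ring)
  refine h.2.congr_deriv ?_
  rw [intervalIntegral.integral_const_mul]
  change Complex.I * besselCosIntegral m r = _
  have h1 := besselIntegral_succ m r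
  have h2 : (2 * m + 1 : ℂ) ≠ 0 := by exact_mod_cast (2 * m).succ_ne_zero
  push_cast
  field_simp
  linear_combination (-Complex.I) * h1 + r * besselIntegral (m + 1) r * Complex.I_sq

theorem continuous_besselIntegral (m : ℕ) : Continuous (besselIntegral m) :=
  continuous_iff_continuousAt.2 fun r => (hasDerivAt_besselIntegral m r).continuousAt

/-- Substituting t = cos θ exhibits P_0 as the Fourier transform of (1 - t²)^{-1/2} on (-1, 1), so
Riemann–Lebesgue applies. -/
theorem tendsto_besselIntegral_zero : Tendsto (besselIntegral 0) atTop (nhds 0) := by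
  have hinj : Set.InjOn Real.cos (Set.Ioo 0 Real.pi) :=
    Real.injOn_cos.mono Set.Ioo_subset_Icc_self
  have hd : ∀ θ ∈ Set.Ioo 0 Real.pi, HasDerivWithinAt Real.cos (-Real.sin θ) (Set.Ioo 0 Real.pi) θ :=
    fun θ _ => (Real.hasDerivAt_cos θ).hasDerivWithinAt
  set f : ℝ → ℂ := (Real.cos '' Set.Ioo 0 Real.pi).indicator fun t => ((1 / √(1 - t ^ 2) : ℝ) : ℂ)
  have hmeas : MeasurableSet (Real.cos '' Set.Ioo 0 Real.pi) :=
    measurableSet_Ioo.image_of_continuousOn_injOn Real.continuous_cos.continuousOn hinj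
  have key : ∀ r : ℝ, besselIntegral 0 r =
      ∫ t : ℝ, Real.fourierChar (-(t * -(r / (2 * Real.pi)))) • f t := by
    intro r
    have e1 : ∀ t : ℝ, Real.fourierChar (-(t * -(r / (2 * Real.pi)))) • f t =
        (Real.cos '' Set.Ioo 0 Real.pi).indicator
          (fun t => Complex.exp (Complex.I * (r * t : ℝ)) * ((1 / √(1 - t ^ 2) : ℝ) : ℂ)) t := by
      intro t
      by_cases ht : t ∈ Real.cos '' Set.Ioo 0 Real.pi
      · simp only [f, Set.indicator_of_mem ht]
        rw [Circle.smul_def, Real.fourierChar_apply, smul_eq_mul]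
        congr 2
        have := Real.pi_ne_zero
        rw [mul_comm]
        congr 2
        field_simp
      · simp only [f, Set.indicator_of_notMem ht, smul_zero]
    simp_rw [e1]
    rw [integral_indicator hmeas, integral_image_eq_integral_abs_deriv_smul measurableSet_Ioo hd hinj,
      besselIntegral, intervalIntegral.integral_of_le Real.pi_pos.le, integral_Ioc_eq_integral_Ioo]
    refine setIntegral_congr_fun measurableSet_Ioo fun θ hθ => ?_
    have hs : 0 < Real.sin θ := Real.sin_pos_of_mem_Ioo hθ
    have : √(1 - Real.cos θ ^ 2) = Real.sin θ := by
      rw [← Real.sin_sq, Real.sqrt_sq hs.le]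
    simp only [this, abs_neg, abs_of_pos hs, mul_zero, pow_zero, Complex.ofReal_one, mul_one]
    rw [Complex.real_smul, mul_left_comm, ← Complex.ofReal_mul, mul_one_div_cancel hs.ne']
    simp
  -- Integrability of `f` need not be checked: for a non-integrable function the integrals are 0 by
  -- convention and the limit is trivial.
  have hRL := Real.tendsto_integral_exp_smul_cocompact f
  have h2 : Tendsto (fun r : ℝ => -(r / (2 * Real.pi))) atTop (cocompact ℝ) := by
    rw [cocompact_eq_atBot_atTop]
    refine Tendsto.mono_right ?_ le_sup_left
    exact tendsto_neg_atTop_atBot.comp (tendsto_id.atTop_div_const (by positivity))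
  refine (hRL.comp h2).congr fun r => ?_
  rw [key]; rfl

/-! ### Radial oscillatory integrals by repeated integration by parts. -/

section RadialBound
variable {X : Type*} [NormedAddCommGroup X] [NormedSpace ℂ X]

/-- The operator `c + r d/dr`. -/
def eulerOp (c : ℝ) (v : ℝ → X) (r : ℝ) : X := c • v r + r • deriv v r

theorem contDiff_eulerOp (c : ℝ) {m : ℕ} {v : ℝ → X} (hv : ContDiff ℝ (m + 1 : ℕ) v) :
    ContDiff ℝ m (eulerOp c v) := by
  have h1 : ContDiff ℝ m (deriv v) := by
    have : ContDiff ℝ ((m : WithTop ℕ∞) + 1) v := by exact_mod_cast hv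
    exact (contDiff_succ_iff_deriv.1 this).2.2
  have h2 : ContDiff ℝ m v := hv.of_le (by exact_mod_cast m.le_succ)
  exact (h2.const_smul c).add (contDiff_id.smul h1)

theorem iteratedDeriv_eulerOp (c : ℝ) {m : ℕ} {v : ℝ → X} (hv : ContDiff ℝ (m + 1 : ℕ) v)
    {j : ℕ} (hj : j ≤ m) :
    iteratedDeriv j (eulerOp c v) =
      fun r => (c + j) • iteratedDeriv j v r + r • iteratedDeriv (j + 1) v r := by
  induction j with
  | zero => funext r; simp [eulerOp, iteratedDeriv_one]
  | succ j ih =>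
    rw [iteratedDeriv_succ, ih (Nat.le_of_succ_le hj)]
    funext r
    have hd : ∀ i, i ≤ m → HasDerivAt (iteratedDeriv i v) (iteratedDeriv (i + 1) v r) r := by
      intro i hi
      rw [iteratedDeriv_succ]
      exact (hv.differentiable_iteratedDeriv i (by exact_mod_cast Nat.lt_succ_of_le hi) r).hasDerivAt
    have h := ((hd j (Nat.le_of_succ_le hj)).const_smul (c + j)).add
      ((hasDerivAt_id r).smul (hd (j + 1) hj))
    refine h.deriv.trans ?_
    simp only [id, one_smul]
    push_cast
    module

theorem integrableOn_besselIntegral_smul (m a : ℕ) {R : ℝ} (hR : 0 < R) {w : ℝ → X}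
    (hw : Continuous w) {G : ℝ → ℝ} (hG : IntegrableOn G (Set.Ioi 0))
    (hwG : ∀ r, 0 < r → r ^ a * ‖w r‖ ≤ G r) :
    IntegrableOn (fun r : ℝ => (((r ^ (a + m) : ℝ) : ℂ) * besselIntegral m (R * r)) • w r)
      (Set.Ioi 0) := by
  obtain ⟨C, hC⟩ := exists_besselIntegral_decay m
  have hcont := continuous_besselIntegral m
  refine Integrable.mono' (hG.const_mul (C / R ^ m))
    (Continuous.aestronglyMeasurable (by fun_prop)) ?_
  filter_upwards [ae_restrict_mem measurableSet_Ioi] with r (hr : 0 < r)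
  have h1 := (hC (R * r) (by positivity)).1
  have hC0 : 0 ≤ C := le_trans (by positivity) h1
  rw [norm_smul, norm_mul, Complex.norm_real, norm_pow, Real.norm_of_nonneg hr.le]
  calc r ^ (a + m) * ‖besselIntegral m (R * r)‖ * ‖w r‖
      = ((R * r) ^ m * ‖besselIntegral m (R * r)‖) / R ^ m * (r ^ a * ‖w r‖) := by
        rw [mul_pow, pow_add]
        field_simp
    _ ≤ C / R ^ m * G r := by
        gcongr
        exact hwG r hr

/-- Integrability of both f and f' forces f → 0 at infinity, so no separate decay hypothesis is
needed for the boundary term there. -/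
theorem integral_Ioi_deriv_eq_neg {f f' : ℝ → X} [CompleteSpace X] (hf : ∀ x, HasDerivAt f (f' x) x)
    (hi : IntegrableOn f (Set.Ioi 0)) (hi' : IntegrableOn f' (Set.Ioi 0)) :
    ∫ r in Set.Ioi 0, f' r = -f 0 := by
  have h := tendsto_zero_of_hasDerivAt_of_integrableOn_Ioi (fun x (_ : x ∈ Set.Ioi (0 : ℝ)) => hf x) hi' hi
  rw [integral_Ioi_of_hasDerivAt_of_tendsto' (fun x _ => hf x) hi' h, zero_sub]

theorem hasDerivAt_besselIntegral_mul (m : ℕ) (R r : ℝ) :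
    HasDerivAt (fun r => besselIntegral m (R * r))
      (-((R ^ 2 * r / (2 * m + 1) : ℝ) : ℂ) * besselIntegral (m + 1) (R * r)) r := by
  have h := (hasDerivAt_besselIntegral m (R * r)).scomp r ((hasDerivAt_id r).const_mul R)
  refine h.congr_deriv ?_
  rw [Complex.real_smul]
  push_cast
  ring

/-- The radial oscillatory integral `∫_0^∞ R^{2m} r^{2m-1} P_m(Rr) v(r) dr`, with `m` shifted
by one. -/
def besselRadialIntegral (m : ℕ) (R : ℝ) (v : ℝ → X) : X :=
  ∫ r in Set.Ioi (0 : ℝ), (((R ^ (2 * m + 2) * r ^ (2 * m + 1) : ℝ) : ℂ) *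
    besselIntegral (m + 1) (R * r)) • v r

theorem integrableOn_besselRadialIntegral (m : ℕ) {R : ℝ} (hR : 0 < R) {w : ℝ → X}
    (hw : Continuous w) {G : ℝ → ℝ} (hG : IntegrableOn G (Set.Ioi 0))
    (hwG : ∀ r, 0 < r → r ^ m * ‖w r‖ ≤ G r) :
    IntegrableOn (fun r : ℝ => (((R ^ (2 * m + 2) * r ^ (2 * m + 1) : ℝ) : ℂ) *
      besselIntegral (m + 1) (R * r)) • w r)
      (Set.Ioi 0) := by
  have h := (integrableOn_besselIntegral_smul (m + 1) m hR hw hG hwG).smul (((R ^ (2 * m + 2) : ℝ) : ℂ))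
  refine h.congr (Eventually.of_forall fun r => ?_)
  simp only [Pi.smul_apply, smul_smul]
  congr 1
  push_cast
  ring

/-- The function integrated is the derivative of P_0(Rr) v(r). Its value π v(0) at the origin is the
only nonzero boundary term of the whole reduction. -/
theorem besselRadialIntegral_zero [CompleteSpace X] {R : ℝ} (hR : 0 < R) {v : ℝ → X}
    (hv : ContDiff ℝ 1 v) {G : ℝ → ℝ} (hG : IntegrableOn G (Set.Ioi 0))
    (h0 : ∀ r, 0 < r → ‖v r‖ ≤ G r) (h1 : ∀ r, 0 < r → ‖deriv v r‖ ≤ G r) :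
    besselRadialIntegral 0 R v = (Real.pi : ℂ) • v 0 +
      ∫ r in Set.Ioi (0 : ℝ), besselIntegral 0 (R * r) • deriv v r := by
  have hv' : Continuous (deriv v) := hv.continuous_deriv le_rfl
  have hd : ∀ r, HasDerivAt v (deriv v r) r := fun r => (hv.differentiable one_ne_zero r).hasDerivAt
  have i1 := integrableOn_besselRadialIntegral 0 hR hv.continuous hG (by simpa using h0)
  have i2 : IntegrableOn (fun r : ℝ => besselIntegral 0 (R * r) • deriv v r) (Set.Ioi 0) := by
    simpa using integrableOn_besselIntegral_smul 0 0 hR hv' hG (by simpa using h1)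
  have i0 : IntegrableOn (fun r : ℝ => besselIntegral 0 (R * r) • v r) (Set.Ioi 0) := by
    simpa using integrableOn_besselIntegral_smul 0 0 hR hv.continuous hG (by simpa using h0)
  have hf : ∀ r, HasDerivAt (fun r : ℝ => besselIntegral 0 (R * r) • v r)
      (besselIntegral 0 (R * r) • deriv v r -
        (((R ^ (2 * 0 + 2) * r ^ (2 * 0 + 1) : ℝ) : ℂ) * besselIntegral (0 + 1) (R * r)) • v r) r := by
    intro r
    refine ((hasDerivAt_besselIntegral_mul 0 R r).smul (hd r)).congr_deriv ?_
    push_cast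
    module
  have h := integral_Ioi_deriv_eq_neg hf i0 (i2.sub i1)
  rw [integral_sub i2 i1] at h
  have hpi : besselIntegral 0 0 = (Real.pi : ℂ) := by rw [besselIntegral_zero_right]; simp
  rw [mul_zero R, hpi] at h
  rw [besselRadialIntegral, ← sub_eq_iff_eq_add', ← neg_sub, ← sub_eq_zero]
  rw [sub_eq_iff_eq_add] at h
  rw [h]
  abel

/-- The primitive is R^{2m+2} r^{2m+2} P_{m+1}(Rr) v(r), which vanishes at 0. Differentiating the
power and v produces the Euler operator; differentiating P_{m+1} produces P_{m+2} with factor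
1/(2m+3). -/
theorem besselRadialIntegral_succ [CompleteSpace X] (m : ℕ) {R : ℝ} (hR : 0 < R) {v : ℝ → X}
    (hv : ContDiff ℝ 1 v) {G : ℝ → ℝ} (hG : IntegrableOn G (Set.Ioi 0))
    (h0 : ∀ r, 0 < r → r ^ (m + 1) * ‖v r‖ ≤ G r)
    (h1 : ∀ r, 0 < r → r ^ m * ‖eulerOp (2 * m + 2) v r‖ ≤ G r) :
    besselRadialIntegral (m + 1) R v =
      (2 * m + 3 : ℂ) • besselRadialIntegral m R (eulerOp (2 * m + 2) v) := by
  have hv' : Continuous (deriv v) := hv.continuous_deriv le_rfl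
  have hvc := hv.continuous
  have hd : ∀ r, HasDerivAt v (deriv v r) r := fun r => (hv.differentiable one_ne_zero r).hasDerivAt
  have hE : Continuous (eulerOp (2 * m + 2) v) := by unfold eulerOp; fun_prop
  have i1 := integrableOn_besselRadialIntegral (m + 1) hR hv.continuous hG h0
  have i2 := integrableOn_besselRadialIntegral m hR hE hG h1
  have hn : (2 * m + 3 : ℂ) ≠ 0 := by exact_mod_cast (2 * m + 2).succ_ne_zero
  have i0 : IntegrableOn (fun r : ℝ => (((R ^ (2 * m + 2) * r ^ (2 * m + 2) : ℝ) : ℂ) *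
      besselIntegral (m + 1) (R * r)) • v r) (Set.Ioi 0) := by
    have h := (integrableOn_besselIntegral_smul (m + 1) (m + 1) hR hvc hG h0).smul
      (((R ^ (2 * m + 2) : ℝ) : ℂ))
    refine h.congr (Eventually.of_forall fun r => ?_)
    simp only [Pi.smul_apply, smul_smul]
    congr 1
    push_cast
    ring
  have hf : ∀ r, HasDerivAt (fun r : ℝ => (((R ^ (2 * m + 2) * r ^ (2 * m + 2) : ℝ) : ℂ) *
        besselIntegral (m + 1) (R * r)) • v r)
      ((((R ^ (2 * m + 2) * r ^ (2 * m + 1) : ℝ) : ℂ) * besselIntegral (m + 1) (R * r)) •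
          eulerOp (2 * m + 2) v r - (2 * m + 3 : ℂ)⁻¹ •
        (((R ^ (2 * (m + 1) + 2) * r ^ (2 * (m + 1) + 1) : ℝ) : ℂ) *
          besselIntegral (m + 1 + 1) (R * r)) • v r) r := by
    intro r
    have hp : HasDerivAt (fun r : ℝ => ((R ^ (2 * m + 2) * r ^ (2 * m + 2) : ℝ) : ℂ))
        ((R ^ (2 * m + 2) * ((2 * m + 2) * r ^ (2 * m + 1)) : ℝ) : ℂ) r := by
      have := ((hasDerivAt_pow (2 * m + 2) r).const_mul (R ^ (2 * m + 2))).ofReal_comp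
      refine this.congr_deriv ?_
      push_cast
      rfl
    refine ((hp.mul (hasDerivAt_besselIntegral_mul (m + 1) R r)).smul (hd r)).congr_deriv ?_
    have hn' : (2 * (m + 1) + 1 : ℂ) ≠ 0 := by exact_mod_cast (2 * (m + 1)).succ_ne_zero
    rw [eulerOp, ← Complex.coe_smul, ← Complex.coe_smul, Pi.mul_apply]
    match_scalars
    · field_simp
      ring
    · ring
  have h := integral_Ioi_deriv_eq_neg hf i0 (i2.sub (i1.smul (2 * m + 3 : ℂ)⁻¹))
  have i1' := i1.smul (2 * m + 3 : ℂ)⁻¹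
  rw [integral_sub i2 (by exact i1'), integral_smul] at h
  have hz : (((R ^ (2 * m + 2) * (0 : ℝ) ^ (2 * m + 2) : ℝ) : ℂ) *
      besselIntegral (m + 1) (R * 0)) • v 0 = 0 := by simp
  rw [hz, neg_zero, sub_eq_zero] at h
  rw [besselRadialIntegral, besselRadialIntegral, h, smul_smul, mul_inv_cancel₀ hn, one_smul]

theorem norm_two_mul_natCast_add_three (m : ℕ) : ‖(2 * m + 3 : ℂ)‖ = 2 * m + 3 := by
  have : (2 * m + 3 : ℂ) = ((2 * m + 3 : ℕ) : ℂ) := by push_cast; ring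
  rw [this, Complex.norm_natCast]
  push_cast; ring

/-- Induction on the index. The weight is max(1, r^m) and not r^m because the Euler operator has a
term without the factor r, for which r^m is not dominated by r^{m+1} near 0. -/
theorem exists_besselRadialIntegral_bound [CompleteSpace X] (m : ℕ) :
    ∃ C : ℝ, 0 ≤ C ∧ ∀ (v : ℝ → X) (G : ℝ → ℝ), ContDiff ℝ (m + 1 : ℕ) v →
      IntegrableOn G (Set.Ioi 0) →
      (∀ j ≤ m + 1, ∀ r, 0 < r → max 1 (r ^ m) * ‖iteratedDeriv j v r‖ ≤ G r) → ∀ R, 0 < R →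
      ‖besselRadialIntegral m R v - ((Real.pi * (2 * m + 1).factorial : ℝ) : ℂ) • v 0‖ ≤
        C * ∫ r in Set.Ioi (0 : ℝ), ‖besselIntegral 0 (R * r)‖ * G r := by
  induction m with
  | zero =>
    refine ⟨1, zero_le_one, fun v G hv hG hvG R hR => ?_⟩
    have h0 : ∀ r, 0 < r → ‖v r‖ ≤ G r := fun r hr => by simpa using hvG 0 (by simp) r hr
    have h1 : ∀ r, 0 < r → ‖deriv v r‖ ≤ G r := fun r hr => by
      simpa [iteratedDeriv_one] using hvG 1 (by simp) r hr
    rw [besselRadialIntegral_zero hR (by simpa using hv) hG h0 h1]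
    simp only [mul_zero, zero_add, Nat.factorial_one, Nat.cast_one, mul_one, add_sub_cancel_left,
      one_mul]
    refine norm_integral_le_of_norm_le ?_ ?_
    · have hc := continuous_besselIntegral 0
      refine Integrable.bdd_mul (c := Real.pi) hG
        (Continuous.aestronglyMeasurable (by fun_prop)) (Eventually.of_forall fun r => ?_)
      rw [norm_norm]
      exact norm_besselIntegral_le _ _
    · filter_upwards [ae_restrict_mem measurableSet_Ioi] with r hr
      rw [norm_smul]
      exact mul_le_mul_of_nonneg_left (h1 r hr) (norm_nonneg _)
  | succ m ih =>
    obtain ⟨C, hC0, hC⟩ := ih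
    -- 3m + 4 bounds the Euler operator after j ≤ m + 1 derivatives: (2m + 2 + j) + 1. The factor 2m
    -- + 3 comes from `besselRadialIntegral_succ`.
    refine ⟨(2 * m + 3) * (C * (3 * m + 4)), by positivity, fun v G hv hG hvG R hR => ?_⟩
    set w := eulerOp (2 * m + 2) v with hw
    have hwc : ContDiff ℝ (m + 1 : ℕ) w := contDiff_eulerOp _ hv
    have hG0 : ∀ r, 0 < r → 0 ≤ G r := fun r hr => le_trans (by positivity) (hvG 0 (by simp) r hr)
    have hwG : ∀ j ≤ m + 1, ∀ r, 0 < r →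
        max 1 (r ^ m) * ‖iteratedDeriv j w r‖ ≤ (3 * m + 4) * G r := by
      intro j hj r hr
      rw [hw, iteratedDeriv_eulerOp _ hv hj]
      have b1 : max 1 (r ^ m) ≤ max 1 (r ^ (m + 1)) := by
        refine max_le (le_max_left _ _) ?_
        rcases le_total r 1 with h | h
        · exact (pow_le_one₀ hr.le h).trans (le_max_left _ _)
        · exact (pow_le_pow_right₀ h (Nat.le_succ m)).trans (le_max_right _ _)
      have b2 : max 1 (r ^ m) * r ≤ max 1 (r ^ (m + 1)) := by
        rw [max_mul_of_nonneg _ _ hr.le, one_mul, ← pow_succ]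
        refine max_le ?_ (le_max_right _ _)
        rcases le_total r 1 with h | h
        · exact h.trans (le_max_left _ _)
        · exact (le_self_pow₀ h (Nat.succ_ne_zero m)).trans (le_max_right _ _)
      have hj' : (j : ℝ) ≤ m + 1 := by exact_mod_cast hj
      have c0 : (0 : ℝ) ≤ 2 * m + 2 + j := by positivity
      calc max 1 (r ^ m) * ‖(2 * m + 2 + j : ℝ) • iteratedDeriv j v r + r • iteratedDeriv (j + 1) v r‖
          ≤ max 1 (r ^ m) * ((2 * m + 2 + j) * ‖iteratedDeriv j v r‖ +
              r * ‖iteratedDeriv (j + 1) v r‖) := by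
            gcongr
            refine (norm_add_le _ _).trans_eq ?_
            rw [norm_smul, norm_smul, Real.norm_of_nonneg hr.le, Real.norm_of_nonneg c0]
        _ = (2 * m + 2 + j) * (max 1 (r ^ m) * ‖iteratedDeriv j v r‖) +
              max 1 (r ^ m) * r * ‖iteratedDeriv (j + 1) v r‖ := by ring
        _ ≤ (2 * m + 2 + (m + 1)) * G r + G r := by
            have := hG0 r hr
            refine add_le_add ?_ ?_
            · refine mul_le_mul (by linarith) ?_ (by positivity) (by positivity)
              exact (mul_le_mul_of_nonneg_right b1 (norm_nonneg _)).trans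
                (hvG j (by omega) r hr)
            · exact (mul_le_mul_of_nonneg_right b2 (norm_nonneg _)).trans
                (hvG (j + 1) (by omega) r hr)
        _ = (3 * m + 4) * G r := by ring
    have hb := hC w (fun r => (3 * m + 4) * G r) hwc (hG.const_mul _) hwG R hR
    have hs := besselRadialIntegral_succ m hR (hv.of_le (by exact_mod_cast Nat.le_add_left 1 _))
      (hG.const_mul (3 * m + 4)) (fun r hr => ?_) (fun r hr => ?_)
    · have h0 : w 0 = (2 * m + 2 : ℂ) • v 0 := by
        rw [hw, eulerOp, zero_smul, add_zero, ← Complex.coe_smul]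
        push_cast; rfl
      -- The Euler operator multiplies the value at 0 by 2m + 2, so (2m+1)! grows to (2m+3)!.
      have hfac : ((Real.pi * (2 * (m + 1) + 1).factorial : ℝ) : ℂ) • v 0 =
          (2 * m + 3 : ℂ) • ((Real.pi * (2 * m + 1).factorial : ℝ) : ℂ) • w 0 := by
        rw [h0, smul_smul, smul_smul]
        congr 1
        rw [show 2 * (m + 1) + 1 = (2 * m + 1) + 1 + 1 by ring, Nat.factorial_succ,
          Nat.factorial_succ]
        push_cast; ring
      rw [hs, hfac, ← smul_sub, norm_smul, norm_two_mul_natCast_add_three, mul_assoc]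
      refine mul_le_mul_of_nonneg_left (hb.trans_eq ?_) (by positivity)
      simp_rw [mul_left_comm _ (3 * (m : ℝ) + 4)]
      rw [integral_const_mul, mul_assoc]
    · have h1 := hvG 0 (by simp) r hr
      rw [iteratedDeriv_zero] at h1
      have h2 : r ^ (m + 1) * ‖v r‖ ≤ G r :=
        (mul_le_mul_of_nonneg_right (le_max_right _ _) (norm_nonneg _)).trans h1
      have h3 : 0 ≤ (m : ℝ) * G r := mul_nonneg (Nat.cast_nonneg _) (hG0 r hr)
      nlinarith [hG0 r hr]
    · have h1 := hwG 0 (by simp) r hr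
      rw [iteratedDeriv_zero] at h1
      exact (mul_le_mul_of_nonneg_right (le_max_right _ _) (norm_nonneg _)).trans h1

end RadialBound

/-! ### From multi-index derivatives to derivatives along a direction. -/

section DirectionalDerivative
variable {X : Type*} [NormedAddCommGroup X] [NormedSpace ℂ X]
  {E : Type*} [NormedAddCommGroup E] [NormedSpace ℝ E]

/-- The iterated directional derivative along a list of directions. -/
def listDeriv (F : E → X) : List E → E → X
  | [] => F
  | a :: l => fun x => fderiv ℝ (listDeriv F l) x a

theorem contDiff_listDeriv {F : E → X} (l : List E) {m : ℕ} (hF : ContDiff ℝ (m + l.length : ℕ) F) :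
    ContDiff ℝ m (listDeriv F l) := by
  induction l generalizing m with
  | nil => simpa [listDeriv] using hF
  | cons a l ih =>
    have h : ContDiff ℝ (m + 1 : ℕ) (listDeriv F l) := ih (by
      convert hF using 2
      simp only [List.length_cons]
      ring)
    exact (h.fderiv_right (m := m) (by norm_cast)).clm_apply contDiff_const

/-- Induction on `List.Perm` reduces the symmetry of higher derivatives to swapping two adjacent
directions, which is symmetry of the second derivative. -/
theorem listDeriv_perm {F : E → X} {l l' : List E} (h : l.Perm l')
    (hF : ContDiff ℝ (l.length : ℕ) F) : listDeriv F l = listDeriv F l' := by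
  induction h with
  | nil => rfl
  | cons a _ ih =>
    rw [listDeriv, listDeriv, ih (hF.of_le (by exact_mod_cast Nat.le_succ _))]
  | swap a b l =>
    have h2 : ContDiff ℝ 2 (listDeriv F l) := contDiff_listDeriv (m := 2) l (by
      convert hF using 2
      simp only [List.length_cons]
      ring)
    funext x
    have hd : DifferentiableAt ℝ (fderiv ℝ (listDeriv F l)) x :=
      (h2.fderiv_right (m := 1) (by norm_num)).differentiable one_ne_zero x
    have key : ∀ c d : E, fderiv ℝ (fun y => fderiv ℝ (listDeriv F l) y c) x d =
        fderiv ℝ (fderiv ℝ (listDeriv F l)) x d c := by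
      intro c d
      rw [fderiv_clm_apply hd (differentiableAt_const c)]
      simp
    simp only [listDeriv]
    rw [key, key]
    exact (h2.contDiffAt.isSymmSndFDerivAt (by simp)) _ _
  | trans h1 _ ih1 ih2 =>
    rw [ih1 hF, ih2 (by rwa [← h1.length_eq])]

theorem iteratedFDeriv_eq_listDeriv {F : E → X} {m : ℕ} (hF : ContDiff ℝ (m : ℕ) F) (v : Fin m → E) :
    (fun x => iteratedFDeriv ℝ m F x v) = listDeriv F (List.ofFn v) := by
  induction m with
  | zero => funext x; simp [listDeriv]
  | succ m ih =>
    funext x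
    rw [List.ofFn_succ, listDeriv, ← ih (hF.of_le (by exact_mod_cast m.le_succ)),
      iteratedFDeriv_succ_apply_left]
    have hd : DifferentiableAt ℝ (iteratedFDeriv ℝ m F) x :=
      hF.differentiable_iteratedFDeriv (by exact_mod_cast m.lt_succ_self) x
    have := (hd.hasFDerivAt.continuousMultilinear_apply_const (fun i : Fin m => v i.succ)).fderiv
    exact (DFunLike.congr_fun this (v 0)).symm

theorem exists_multiPartialDeriv_eq {n j : ℕ} {F : EuclideanSpace ℝ (Fin n) → X}
    (hF : ContDiff ℝ (j : ℕ) F) (f : Fin j → Fin n) :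
    ∃ α : Fin n → ℕ, ∑ i, α i = j ∧ ∀ x, iteratedFDeriv ℝ j F x
      (fun i => EuclideanSpace.single (f i) (1 : ℝ)) = multiPartialDeriv α F x := by
  -- α counts the occurrences of each index in `f`, and `e` sorts the positions by grouping them
  -- into the fibres of `f`.
  obtain ⟨α, e, he⟩ : ∃ (α : Fin n → ℕ) (e : Fin j ≃ Fin (∑ i, α i)),
      ∀ a, (finSigmaFinEquiv.symm (e a)).1 = f a := by
    refine ⟨fun i => Fintype.card {a // f a = i}, ((Equiv.sigmaFiberEquiv f).symm.trans
      (Equiv.sigmaCongrRight fun i => Fintype.equivFin {a // f a = i})).trans finSigmaFinEquiv,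
      fun a => ?_⟩
    simp [Equiv.sigmaFiberEquiv, Equiv.sigmaCongrRight]
  have hj : ∑ i, α i = j := by simpa using (Fintype.card_congr e).symm
  refine ⟨α, hj, fun x => ?_⟩
  subst hj
  rw [multiPartialDeriv]
  have h1 := congrFun (iteratedFDeriv_eq_listDeriv hF
    (fun i => EuclideanSpace.single (f i) (1 : ℝ))) x
  have h2 := congrFun (iteratedFDeriv_eq_listDeriv hF
    (fun i => EuclideanSpace.single (finSigmaFinEquiv.symm i).1 (1 : ℝ))) x
  beta_reduce at h1 h2
  rw [h1, h2, listDeriv_perm _ (by simpa using hF)]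
  have h3 := Equiv.Perm.ofFn_comp_perm e
    (fun i => EuclideanSpace.single (finSigmaFinEquiv.symm i).1 (1 : ℝ))
  simpa only [Function.comp_def, he] using h3

/-- Expanding w in the standard basis gives n^j terms with coefficients at most 1, each a
multi-index derivative up to reordering. -/
theorem norm_iteratedFDeriv_le_of_multiPartialDeriv {n j : ℕ} {F : EuclideanSpace ℝ (Fin n) → X}
    (hF : ContDiff ℝ (j : ℕ) F) {x w : EuclideanSpace ℝ (Fin n)} {B : ℝ} (hw : ‖w‖ = 1)
    (hB : ∀ α : Fin n → ℕ, ∑ i, α i = j → ‖multiPartialDeriv α F x‖ ≤ B) :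
    ‖iteratedFDeriv ℝ j F x (fun _ => w)‖ ≤ n ^ j * B := by
  have hsum : w = ∑ i, w i • EuclideanSpace.single i (1 : ℝ) := by
    have := ((EuclideanSpace.basisFun (Fin n) ℝ).sum_repr w).symm
    simpa using this
  have hw1 : ∀ i, |w i| ≤ 1 := fun i => by
    rw [← hw, ← Real.norm_eq_abs]; exact PiLp.norm_apply_le w i
  calc ‖iteratedFDeriv ℝ j F x (fun _ => w)‖
      = ‖∑ f : Fin j → Fin n, (∏ i, w (f i)) • iteratedFDeriv ℝ j F x
          (fun i => EuclideanSpace.single (f i) (1 : ℝ))‖ := by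
        conv_lhs => rw [hsum, ContinuousMultilinearMap.map_sum]
        simp_rw [ContinuousMultilinearMap.map_smul_univ]
    _ ≤ ∑ f : Fin j → Fin n, B := by
        refine norm_sum_le_of_le _ fun f _ => ?_
        obtain ⟨α, hα, h⟩ := exists_multiPartialDeriv_eq hF f
        rw [norm_smul, h x, norm_prod]
        have : ∏ i, ‖w (f i)‖ ≤ 1 := Finset.prod_le_one (fun _ _ => norm_nonneg _) fun i _ => hw1 _
        exact (mul_le_of_le_one_left (norm_nonneg _) this).trans (hB α hα)
    _ = n ^ j * B := by simp

theorem iteratedDeriv_comp_line {F : E → X} {k : ℕ} (hF : ContDiff ℝ (k : ℕ) F) (x w : E)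
    {j : ℕ} (hj : j ≤ k) :
    iteratedDeriv j (fun r : ℝ => F (x + r • w)) =
      fun r => iteratedFDeriv ℝ j F (x + r • w) (fun _ => w) := by
  induction j with
  | zero => funext r; simp
  | succ j ih =>
    rw [iteratedDeriv_succ, ih (Nat.le_of_succ_le hj)]
    funext r
    have hd : DifferentiableAt ℝ (iteratedFDeriv ℝ j F) (x + r • w) :=
      hF.differentiable_iteratedFDeriv (by exact_mod_cast hj) _
    have hl : HasDerivAt (fun r : ℝ => x + r • w) w r := by
      simpa using ((hasDerivAt_id r).smul_const w).const_add x
    have := (hd.hasFDerivAt.continuousMultilinear_apply_const (fun _ : Fin j => w)).comp_hasDerivAt r hl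
    rw [iteratedFDeriv_succ_apply_left]
    exact this.deriv

end DirectionalDerivative

/-! ### Fourier transform of a ball. -/

theorem volume_real_sum_sq_le (m : ℕ) {s : ℝ} (hs : 0 ≤ s) :
    volume.real {z : Fin m → ℝ | ∑ i, z i ^ 2 ≤ s} =
      √s ^ m * volume.real (Metric.ball (0 : EuclideanSpace ℝ (Fin m)) 1) := by
  have h := Measure.addHaar_real_closedBall (volume : Measure (EuclideanSpace ℝ (Fin m))) 0
    (Real.sqrt_nonneg s)
  rw [finrank_euclideanSpace_fin] at h
  rw [← h, Measure.real, Measure.real]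
  congr 1
  have hp := (EuclideanSpace.volume_preserving_symm_measurableEquiv_toLp (Fin m)).measure_preimage_equiv
    {z : Fin m → ℝ | ∑ i, z i ^ 2 ≤ s}
  rw [← hp]
  congr 1
  ext z
  rw [Set.mem_preimage, mem_closedBall_zero_iff, EuclideanSpace.norm_eq, Real.sqrt_le_sqrt_iff hs]
  simp

/-- Fubini along the first axis: the slice at height t is an m-dimensional ball of radius √(1 - t²).
-/
theorem setIntegral_closedBall_apply_zero (m : ℕ) {φ : ℝ → ℂ} (hφ : Continuous φ) :
    ∫ ξ in Metric.closedBall (0 : EuclideanSpace ℝ (Fin (m + 1))) 1, φ (ξ 0) =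
      (volume.real (Metric.ball (0 : EuclideanSpace ℝ (Fin m)) 1) : ℂ) *
        ∫ t in (-1 : ℝ)..1, φ t * ((√(1 - t ^ 2) ^ m : ℝ) : ℂ) := by
  let e : EuclideanSpace ℝ (Fin (m + 1)) ≃ᵐ ℝ × (Fin m → ℝ) :=
    (MeasurableEquiv.toLp 2 (Fin (m + 1) → ℝ)).symm.trans
      (MeasurableEquiv.piFinSuccAbove (fun _ => ℝ) 0)
  have he : MeasurePreserving e volume volume :=
    (EuclideanSpace.volume_preserving_symm_measurableEquiv_toLp (Fin (m + 1))).trans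
      (volume_preserving_piFinSuccAbove (fun _ : Fin (m + 1) => ℝ) 0)
  let A : Set (ℝ × (Fin m → ℝ)) := {p | p.1 ^ 2 + ∑ i, p.2 i ^ 2 ≤ 1}
  have hA : e ⁻¹' A = Metric.closedBall 0 1 := by
    ext ξ
    rw [mem_closedBall_zero_iff, EuclideanSpace.norm_eq, Real.sqrt_le_one, Fin.sum_univ_succ]
    simp [A, e, MeasurableEquiv.piFinSuccAbove, Fin.tail]
  have hAm : MeasurableSet A := measurableSet_le (by fun_prop) (by fun_prop)
  have h1 := he.setIntegral_preimage_emb e.measurableEmbedding (fun p => φ p.1) A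
  have hint : Integrable (A.indicator fun p => φ p.1) := by
    rw [integrable_indicator_iff hAm, ← he.integrableOn_comp_preimage e.measurableEmbedding, hA]
    have hc : Continuous ((fun p : ℝ × (Fin m → ℝ) => φ p.1) ∘ e) := by
      change Continuous fun ξ : EuclideanSpace ℝ (Fin (m + 1)) => φ (ξ 0)
      fun_prop
    exact hc.continuousOn.integrableOn_compact (isCompact_closedBall _ _)
  rw [hA] at h1
  change ∫ ξ in Metric.closedBall (0 : EuclideanSpace ℝ (Fin (m + 1))) 1, φ (ξ 0) = _ at h1
  rw [h1, ← integral_indicator hAm, Measure.volume_eq_prod,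
    integral_prod _ (by simpa [Measure.volume_eq_prod] using hint)]
  have h2 : ∀ t : ℝ, ∫ z : Fin m → ℝ, A.indicator (fun p => φ p.1) (t, z) =
      (Set.Icc (-1) 1).indicator (fun t => (volume.real (Metric.ball (0 : EuclideanSpace ℝ (Fin m)) 1) : ℂ) *
        (φ t * ((√(1 - t ^ 2) ^ m : ℝ) : ℂ))) t := by
    intro t
    have h3 : (fun z : Fin m → ℝ => A.indicator (fun p => φ p.1) (t, z)) =
        Set.indicator {z : Fin m → ℝ | ∑ i, z i ^ 2 ≤ 1 - t ^ 2} (fun _ => φ t) := by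
      funext z
      simp only [Set.indicator, A, Set.mem_ofPred_eq]
      congr 1
      rw [le_sub_iff_add_le']
    rw [h3, integral_indicator (measurableSet_le (by fun_prop) (by fun_prop)), setIntegral_const]
    by_cases ht : t ∈ Set.Icc (-1 : ℝ) 1
    · have : 0 ≤ 1 - t ^ 2 := by nlinarith [ht.1, ht.2]
      rw [Set.indicator_of_mem ht, volume_real_sum_sq_le m this, Complex.real_smul]
      push_cast; ring
    · have : {z : Fin m → ℝ | ∑ i, z i ^ 2 ≤ 1 - t ^ 2} = ∅ := by
        ext z
        simp only [Set.mem_ofPred_eq, Set.mem_empty_iff_false, iff_false, not_le]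
        have h0 : 0 ≤ ∑ i, z i ^ 2 := Finset.sum_nonneg fun i _ => sq_nonneg _
        have : 1 < t ^ 2 := by
          by_contra! h
          exact ht ⟨by nlinarith, by nlinarith⟩
        linarith
      rw [Set.indicator_of_notMem ht, this]
      simp
  simp_rw [h2]
  rw [integral_indicator measurableSet_Icc, integral_const_mul, integral_Icc_eq_integral_Ioc,
    ← intervalIntegral.integral_of_le (by norm_num)]

theorem integral_sqrt_one_sub_sq_eq (m : ℕ) {φ : ℝ → ℂ} (hφ : Continuous φ) :
    ∫ t in (-1 : ℝ)..1, φ t * ((√(1 - t ^ 2) ^ m : ℝ) : ℂ) =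
      ∫ θ in (0 : ℝ)..Real.pi, φ (Real.cos θ) * ((Real.sin θ ^ (m + 1) : ℝ) : ℂ) := by
  have h := intervalIntegral.integral_deriv_smul_comp (a := 0) (b := Real.pi) (f := Real.cos)
    (f' := fun θ => -Real.sin θ) (g := fun t => φ t * ((√(1 - t ^ 2) ^ m : ℝ) : ℂ))
    (fun θ _ => Real.hasDerivAt_cos θ) (by fun_prop) (by fun_prop)
  rw [Real.cos_zero, Real.cos_pi, intervalIntegral.integral_symm (-1) 1] at h
  rw [← neg_inj, ← h, ← intervalIntegral.integral_neg]
  refine intervalIntegral.integral_congr fun θ hθ => ?_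
  rw [Set.uIcc_of_le Real.pi_pos.le] at hθ
  have hs := Real.sin_nonneg_of_mem_Icc hθ
  have : √(1 - Real.cos θ ^ 2) = Real.sin θ := by rw [← Real.sin_sq, Real.sqrt_sq hs]
  simp only [Function.comp, this, Complex.real_smul]
  push_cast; ring

theorem exists_linearIsometryEquiv_inner (m : ℕ) (y : EuclideanSpace ℝ (Fin (m + 1))) :
    ∃ U : EuclideanSpace ℝ (Fin (m + 1)) ≃ₗᵢ[ℝ] EuclideanSpace ℝ (Fin (m + 1)),
      ∀ ξ, inner ℝ y ξ = ‖y‖ * (U ξ) 0 := by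
  let v : EuclideanSpace ℝ (Fin (m + 1)) := EuclideanSpace.single 0 ‖y‖
  have hv : ‖y‖ = ‖v‖ := by simp [v]
  -- This reflection sends y to the vector v of equal length on the first axis.
  refine ⟨(Submodule.span ℝ {y - v})ᗮ.reflection, fun ξ => ?_⟩
  rw [← LinearIsometryEquiv.inner_map_map ((Submodule.span ℝ {y - v})ᗮ.reflection) y ξ,
    Submodule.reflection_sub hv]
  simp [v, EuclideanSpace.inner_single_left]

theorem setIntegral_closedBall_exp_inner (m : ℕ) (y : EuclideanSpace ℝ (Fin (m + 1))) :
    ∫ ξ in Metric.closedBall (0 : EuclideanSpace ℝ (Fin (m + 1))) 1,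
        Complex.exp (Complex.I * ((inner ℝ y ξ : ℝ) : ℂ)) =
      (volume.real (Metric.ball (0 : EuclideanSpace ℝ (Fin m)) 1) : ℂ) *
        ∫ θ in (0 : ℝ)..Real.pi, Complex.exp (Complex.I * (‖y‖ * Real.cos θ : ℝ)) *
          ((Real.sin θ ^ (m + 1) : ℝ) : ℂ) := by
  obtain ⟨U, hU⟩ := exists_linearIsometryEquiv_inner m y
  have h1 := U.measurePreserving.setIntegral_preimage_emb U.toMeasurableEquiv.measurableEmbedding
    (fun ξ => Complex.exp (Complex.I * (‖y‖ * ξ 0 : ℝ))) (Metric.closedBall 0 1)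
  rw [LinearIsometryEquiv.preimage_closedBall, map_zero] at h1
  simp_rw [hU]
  rw [h1, setIntegral_closedBall_apply_zero m
    (φ := fun t => Complex.exp (Complex.I * (‖y‖ * t : ℝ))) (by fun_prop),
    integral_sqrt_one_sub_sq_eq m (φ := fun t => Complex.exp (Complex.I * (‖y‖ * t : ℝ)))
      (by fun_prop)]

theorem besselIntegral_zero_right_ne_zero (m : ℕ) : besselIntegral m 0 ≠ 0 := by
  rw [besselIntegral_zero_right, Complex.ofReal_ne_zero]
  exact mul_ne_zero Real.pi_ne_zero (Finset.prod_ne_zero_iff.2 fun i _ => by positivity)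

/-- The Fourier transform of the indicator function of a ball in even dimension. -/
theorem setIntegral_closedBall_exp_inner_eq_besselIntegral {n k : ℕ} (hk : 1 ≤ k) (hn : n = 2 * k)
    {R : ℝ} (hR : 0 < R) (y : EuclideanSpace ℝ (Fin n)) :
    ∫ ξ in Metric.closedBall (0 : EuclideanSpace ℝ (Fin n)) R,
        Complex.exp (Complex.I * ((inner ℝ y ξ : ℝ) : ℂ)) =
      ((R ^ (2 * k) * (Real.pi ^ k / k.factorial) : ℝ) : ℂ) / besselIntegral k 0 *
        besselIntegral k (R * ‖y‖) := by
  obtain ⟨l, rfl⟩ : ∃ l, k = l + 1 := ⟨k - 1, by omega⟩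
  obtain ⟨m, rfl⟩ : ∃ m, n = m + 1 := ⟨n - 1, by omega⟩
  have hexp : m + 1 = 2 * (l + 1) := hn
  have hpow : R ^ (m + 1) = R ^ (2 * (l + 1)) := by rw [hexp]
  have hB : ∀ r : ℝ, ∫ θ in (0 : ℝ)..Real.pi, Complex.exp (Complex.I * (r * Real.cos θ : ℝ)) *
      ((Real.sin θ ^ (m + 1) : ℝ) : ℂ) = besselIntegral (l + 1) r := fun r => by rw [hexp]; rfl
  -- Evaluating at frequency 0 ties the volume of the (2k-1)-dimensional ball to that of the
  -- 2k-dimensional one, so it never has to be computed.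
  have hV : (volume.real (Metric.ball (0 : EuclideanSpace ℝ (Fin m)) 1) : ℂ) * besselIntegral (l + 1) 0 =
      ((Real.pi ^ (l + 1) / (l + 1).factorial : ℝ) : ℂ) := by
    have h0 := setIntegral_closedBall_exp_inner m 0
    simp only [norm_zero, inner_zero_left, Complex.ofReal_zero, mul_zero, Complex.exp_zero,
      setIntegral_const] at h0
    rw [besselIntegral, ← hexp]
    rw [Measure.real, InnerProductSpace.volume_closedBall_of_dim_even (k := l + 1) (by simpa using hn)] at h0
    rw [ENNReal.ofReal_one, one_pow, one_mul, ENNReal.toReal_ofReal (by positivity),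
      Complex.real_smul, mul_one] at h0
    simp only [zero_mul, Complex.ofReal_zero, mul_zero, Complex.exp_zero] at h0 ⊢
    exact h0.symm
  have hs := Measure.setIntegral_comp_smul (volume : Measure (EuclideanSpace ℝ (Fin (m + 1))))
    (fun ξ => Complex.exp (Complex.I * ((inner ℝ y ξ : ℝ) : ℂ))) (Metric.closedBall 0 1) hR.ne'
  rw [smul_closedBall _ _ zero_le_one, smul_zero, mul_one, Real.norm_of_nonneg hR.le,
    finrank_euclideanSpace_fin, hpow, abs_of_pos (by positivity)] at hs
  simp_rw [inner_smul_right, ← real_inner_smul_left] at hs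
  rw [setIntegral_closedBall_exp_inner m (R • y), norm_smul, Real.norm_of_nonneg hR.le, hB] at hs
  rw [Complex.ofReal_mul, ← hV, mul_div_assoc, mul_div_cancel_right₀ _
    (besselIntegral_zero_right_ne_zero _), mul_assoc, hs, Complex.real_smul, ← mul_assoc,
    ← Complex.ofReal_mul, mul_inv_cancel₀ (by positivity), Complex.ofReal_one, one_mul]

/-! ### Polar coordinates for vector-valued integrals. -/

section Polar
open Measure Set Metric
theorem comp_homeomorphUnitSphereProd {E Y : Type*} [NormedAddCommGroup E] [NormedSpace ℝ E]
    (f : E → Y) :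
    (fun p : sphere (0 : E) 1 × Ioi (0 : ℝ) => f ((p.2 : ℝ) • (p.1 : E))) ∘ homeomorphUnitSphereProd E =
      fun x : ({0}ᶜ : Set E) => f x := by
  funext x
  have hx : ‖(x : E)‖ ≠ 0 := norm_ne_zero_iff.2 x.2
  simp [smul_smul, hx]

variable {Y : Type*} [NormedAddCommGroup Y] [NormedSpace ℝ Y]

theorem integrable_volumeIoiPow_iff (n : ℕ) (h : ℝ → Y) :
    Integrable (fun r : Ioi (0 : ℝ) => h r) (volumeIoiPow n) ↔
      IntegrableOn (fun r : ℝ => r ^ n • h r) (Ioi 0) := by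
  rw [integrableOn_iff_comap_subtypeVal measurableSet_Ioi, volumeIoiPow,
    integrable_withDensity_iff_integrable_smul', integrable_congr]
  · refine .of_forall ?_
    rintro ⟨x, hx : 0 < x⟩
    simp (disch := positivity) [ENNReal.toReal_ofReal]
  · fun_prop
  · simp

theorem integral_volumeIoiPow (n : ℕ) (h : ℝ → Y) :
    ∫ r : Ioi (0 : ℝ), h r ∂(volumeIoiPow n) = ∫ r in Ioi (0 : ℝ), r ^ n • h r := by
  simp only [volumeIoiPow, ENNReal.ofReal]
  rw [integral_withDensity_eq_integral_smul,
    integral_subtype_comap measurableSet_Ioi fun a ↦ Real.toNNReal (a ^ n) • h a,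
    setIntegral_congr_fun measurableSet_Ioi fun x hx ↦ ?_]
  · rw [NNReal.smul_def, Real.coe_toNNReal _ (pow_nonneg hx.out.le _)]
  · exact (measurable_subtype_coe.pow_const _).real_toNNReal

variable {E : Type*} [NormedAddCommGroup E] [NormedSpace ℝ E] [MeasurableSpace E] [BorelSpace E]
  [FiniteDimensional ℝ E] [Nontrivial E] (μ : Measure E) [μ.IsAddHaarMeasure]

theorem integrable_polar {f : E → Y} (hf : Integrable f μ) :
    Integrable (fun p : sphere (0 : E) 1 × Ioi (0 : ℝ) => f ((p.2 : ℝ) • (p.1 : E)))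
      (μ.toSphere.prod (volumeIoiPow (Module.finrank ℝ E - 1))) := by
  rw [← μ.measurePreserving_homeomorphUnitSphereProd.integrable_comp_emb
    (Homeomorph.measurableEmbedding _), comp_homeomorphUnitSphereProd]
  exact (integrableOn_iff_comap_subtypeVal (measurableSet_singleton _).compl).1 hf.integrableOn

theorem ae_integrableOn_polar {f : E → Y} (hf : Integrable f μ) :
    ∀ᵐ ω : sphere (0 : E) 1 ∂μ.toSphere,
      IntegrableOn (fun r : ℝ => r ^ (Module.finrank ℝ E - 1) • f (r • (ω : E))) (Ioi 0) := by
  filter_upwards [(integrable_polar μ hf).prod_right_ae] with ω hω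
  exact (integrable_volumeIoiPow_iff _ fun r => f (r • (ω : E))).1 hω

theorem integrable_polar_integral {f : E → Y} (hf : Integrable f μ) :
    Integrable (fun ω : sphere (0 : E) 1 =>
      ∫ r in Ioi (0 : ℝ), r ^ (Module.finrank ℝ E - 1) • f (r • (ω : E))) μ.toSphere := by
  have := (integrable_polar μ hf).integral_prod_left
  refine this.congr (Eventually.of_forall fun ω => ?_)
  exact integral_volumeIoiPow _ fun r => f (r • (ω : E))

theorem integral_polar {f : E → Y} (hf : Integrable f μ) :
    ∫ x, f x ∂μ = ∫ ω : sphere (0 : E) 1,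
      (∫ r in Ioi (0 : ℝ), r ^ (Module.finrank ℝ E - 1) • f (r • (ω : E))) ∂μ.toSphere := by
  calc ∫ x, f x ∂μ = ∫ x : ({0}ᶜ : Set E), f x ∂(μ.comap (↑)) := by
        rw [integral_subtype_comap (measurableSet_singleton _).compl, restrict_compl_singleton]
    _ = ∫ p : sphere (0 : E) 1 × Ioi (0 : ℝ), f ((p.2 : ℝ) • (p.1 : E))
          ∂(μ.toSphere.prod (volumeIoiPow (Module.finrank ℝ E - 1))) := by
        rw [← μ.measurePreserving_homeomorphUnitSphereProd.integral_comp
          (Homeomorph.measurableEmbedding _)]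
        exact integral_congr_ae (Eventually.of_forall fun x =>
          (congrFun (comp_homeomorphUnitSphereProd f) x).symm)
    _ = _ := by
        rw [integral_prod _ (integrable_polar μ hf)]
        exact integral_congr_ae (Eventually.of_forall fun ω =>
          integral_volumeIoiPow _ fun r => f (r • (ω : E)))
end Polar

/-! ### Partial inversion as integration against the Dirichlet kernel. -/

section Kernel
variable {X : Type*} [NormedAddCommGroup X] [NormedSpace ℂ X] {n : ℕ}

/-- The spherical Dirichlet kernel. -/
def sphericalDirichletKernel (R : ℝ) (y : EuclideanSpace ℝ (Fin n)) : ℂ :=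
  (1 : ℂ) / (2 * (Real.pi : ℂ)) ^ n *
    ∫ ξ in Metric.closedBall (0 : EuclideanSpace ℝ (Fin n)) R,
      Complex.exp (Complex.I * ((inner ℝ y ξ : ℝ) : ℂ))

/-- Used because the translation s = x + y leaves the kernel evaluated at -y. -/
theorem sphericalDirichletKernel_neg (R : ℝ) (y : EuclideanSpace ℝ (Fin n)) :
    sphericalDirichletKernel R (-y) = sphericalDirichletKernel R y := by
  let U := LinearIsometryEquiv.neg ℝ (E := EuclideanSpace ℝ (Fin n))
  have h1 := U.measurePreserving.setIntegral_preimage_emb U.toMeasurableEquiv.measurableEmbedding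
    (fun ξ => Complex.exp (Complex.I * ((inner ℝ y ξ : ℝ) : ℂ))) (Metric.closedBall 0 R)
  rw [LinearIsometryEquiv.preimage_closedBall, map_zero] at h1
  rw [sphericalDirichletKernel, sphericalDirichletKernel, ← h1]
  simp [U]

theorem integrable_prod_cexp_inner_smul (R : ℝ) {F : EuclideanSpace ℝ (Fin n) → X}
    (hF : Integrable F) (x : EuclideanSpace ℝ (Fin n)) :
    Integrable (fun p : EuclideanSpace ℝ (Fin n) × EuclideanSpace ℝ (Fin n) =>
      Complex.exp (Complex.I * ((inner ℝ (x - p.2) p.1 : ℝ) : ℂ)) • F p.2)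
      ((volume.restrict (Metric.closedBall 0 R)).prod volume) := by
  have : IsFiniteMeasure (volume.restrict (Metric.closedBall (0 : EuclideanSpace ℝ (Fin n)) R)) :=
    ⟨by rw [Measure.restrict_apply_univ]; exact measure_closedBall_lt_top⟩
  have h := hF.comp_snd (volume.restrict (Metric.closedBall (0 : EuclideanSpace ℝ (Fin n)) R))
  refine h.bdd_smul (φ := fun p : EuclideanSpace ℝ (Fin n) × EuclideanSpace ℝ (Fin n) =>
    Complex.exp (Complex.I * ((inner ℝ (x - p.2) p.1 : ℝ) : ℂ))) 1
    (Continuous.aestronglyMeasurable (by fun_prop)) (Eventually.of_forall fun p => ?_)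
  rw [norm_exp_I_mul_real]

theorem fourierPartialInversion_eq_integral_kernel [CompleteSpace X] (R : ℝ)
    {F : EuclideanSpace ℝ (Fin n) → X} (hF : Integrable F) (x : EuclideanSpace ℝ (Fin n)) :
    fourierPartialInversion R F x = ∫ y, sphericalDirichletKernel R y • F (x + y) := by
  have h1 : ∀ k : EuclideanSpace ℝ (Fin n),
      Complex.exp (Complex.I * ((inner ℝ x k : ℝ) : ℂ)) • angularFourier F k =
      ∫ s, Complex.exp (Complex.I * ((inner ℝ (x - s) k : ℝ) : ℂ)) • F s := by
    intro k
    rw [angularFourier, ← integral_smul]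
    congr 1 with s
    rw [smul_smul, ← Complex.exp_add, inner_sub_left, real_inner_comm k s]
    congr 2
    push_cast; ring
  rw [fourierPartialInversion]
  simp_rw [h1]
  rw [integral_integral_swap (integrable_prod_cexp_inner_smul R hF x), ← integral_smul,
    ← integral_add_left_eq_self _ x]
  congr 1 with y
  rw [← sphericalDirichletKernel_neg, sphericalDirichletKernel, mul_smul, integral_smul_const]
  simp only [sub_add_cancel_left]

end Kernel

/-! ### Normalisation, error bound, integrable majorant. -/

section Inversion
variable {X : Type*} [NormedAddCommGroup X] [NormedSpace ℂ X]

theorem prod_range_odd_div_even (k : ℕ) :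
    ∏ i ∈ Finset.range k, ((2 * i + 1 : ℝ) / (2 * i + 2)) =
      (2 * k).factorial / (4 ^ k * (k.factorial : ℝ) ^ 2) := by
  induction k with
  | zero => simp
  | succ k ih =>
    rw [Finset.prod_range_succ, ih, show 2 * (k + 1) = 2 * k + 1 + 1 by ring, Nat.factorial_succ,
      Nat.factorial_succ, Nat.factorial_succ]
    have := Nat.factorial_ne_zero k
    push_cast
    field_simp
    ring

/-- The normalising constant in `sphericalDirichletKernel_eq`. -/
def dirichletConst (k : ℕ) : ℂ :=
  (1 : ℂ) / (2 * (Real.pi : ℂ)) ^ (2 * k) * (((Real.pi ^ k / k.factorial : ℝ) : ℂ) / besselIntegral k 0)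

/-- The factors are the kernel constant, the coefficient of v(0) in the radial bound, and the area
of the unit sphere; their product is the coefficient of F(x) in the limit. -/
theorem dirichletConst_mul_eq_one {k : ℕ} (hk : 1 ≤ k) :
    dirichletConst k * ((Real.pi * (2 * k - 1).factorial : ℝ) : ℂ) *
      ((2 * k * (Real.pi ^ k / k.factorial) : ℝ) : ℂ) = 1 := by
  obtain ⟨l, rfl⟩ : ∃ l, k = l + 1 := ⟨k - 1, by omega⟩
  rw [dirichletConst, besselIntegral_zero_right, prod_range_odd_div_even]
  have h : (1 : ℝ) / (2 * Real.pi) ^ (2 * (l + 1)) * ((Real.pi ^ (l + 1) / (l + 1).factorial) /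
      (Real.pi * ((2 * (l + 1)).factorial / (4 ^ (l + 1) * ((l + 1).factorial : ℝ) ^ 2)))) *
      (Real.pi * (2 * (l + 1) - 1).factorial) *
      (2 * (l + 1 : ℕ) * (Real.pi ^ (l + 1) / (l + 1).factorial)) = 1 := by
    rw [show 2 * (l + 1) - 1 = 2 * l + 1 by omega, show 2 * (l + 1) = 2 * l + 1 + 1 by ring,
      Nat.factorial_succ (2 * l + 1), show (4 : ℝ) = 2 ^ 2 by norm_num, ← pow_mul, mul_pow]
    have h1 := Real.pi_ne_zero
    have h2 := Nat.factorial_ne_zero (2 * l + 1)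
    have h3 := Nat.factorial_ne_zero (l + 1)
    push_cast
    field_simp
    ring
  exact_mod_cast h

theorem sphericalDirichletKernel_eq {n k : ℕ} (hk : 1 ≤ k) (hn : n = 2 * k) {R : ℝ} (hR : 0 < R)
    (y : EuclideanSpace ℝ (Fin n)) :
    sphericalDirichletKernel R y =
      dirichletConst k * (((R ^ (2 * k) : ℝ) : ℂ) * besselIntegral k (R * ‖y‖)) := by
  rw [sphericalDirichletKernel, setIntegral_closedBall_exp_inner_eq_besselIntegral hk hn hR,
    dirichletConst, show (2 * (Real.pi : ℂ)) ^ n = (2 * (Real.pi : ℂ)) ^ (2 * k) by rw [hn]]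
  push_cast
  ring

theorem fourierPartialInversion_eq_besselRadialIntegral [CompleteSpace X] {n l : ℕ} (hn : n = 2 * (l + 1))
    {F : EuclideanSpace ℝ (Fin n) → X} (hF : Integrable F) {R : ℝ} (hR : 0 < R)
    (x : EuclideanSpace ℝ (Fin n)) :
    Integrable (fun ω : Metric.sphere (0 : EuclideanSpace ℝ (Fin n)) 1 =>
      dirichletConst (l + 1) • besselRadialIntegral l R fun r => F (x + r • (ω : EuclideanSpace ℝ (Fin n))))
      (volume : Measure (EuclideanSpace ℝ (Fin n))).toSphere ∧
    fourierPartialInversion R F x = ∫ ω : Metric.sphere (0 : EuclideanSpace ℝ (Fin n)) 1,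
      dirichletConst (l + 1) • besselRadialIntegral l R (fun r => F (x + r • (ω : EuclideanSpace ℝ (Fin n))))
      ∂(volume : Measure (EuclideanSpace ℝ (Fin n))).toSphere := by
  have : Nontrivial (EuclideanSpace ℝ (Fin n)) := by
    have : Nonempty (Fin n) := ⟨⟨0, by omega⟩⟩
    infer_instance
  have hK : ∀ y, sphericalDirichletKernel R y • F (x + y) = (dirichletConst (l + 1) *
      (((R ^ (2 * (l + 1)) : ℝ) : ℂ) * besselIntegral (l + 1) (R * ‖y‖))) • F (x + y) := fun y => by
    rw [sphericalDirichletKernel_eq (by omega) hn hR]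
  have hc := continuous_besselIntegral (l + 1)
  have hint : Integrable (fun y => sphericalDirichletKernel R y • F (x + y)) := by
    simp_rw [hK]
    refine (hF.comp_add_left x).bdd_smul
      (‖dirichletConst (l + 1)‖ * (R ^ (2 * (l + 1)) * Real.pi))
      (Continuous.aestronglyMeasurable (by fun_prop)) (Eventually.of_forall fun y => ?_)
    rw [norm_mul, norm_mul, Complex.norm_real, Real.norm_of_nonneg (by positivity)]
    have := norm_besselIntegral_le (l + 1) (R * ‖y‖)
    gcongr
  have hin : ∀ ω : Metric.sphere (0 : EuclideanSpace ℝ (Fin n)) 1,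
      ∫ r in Set.Ioi (0 : ℝ), r ^ (Module.finrank ℝ (EuclideanSpace ℝ (Fin n)) - 1) •
        (sphericalDirichletKernel R (r • (ω : EuclideanSpace ℝ (Fin n))) •
          F (x + r • (ω : EuclideanSpace ℝ (Fin n)))) =
      dirichletConst (l + 1) • besselRadialIntegral l R
        (fun r => F (x + r • (ω : EuclideanSpace ℝ (Fin n)))) := by
    intro ω
    rw [besselRadialIntegral, ← integral_smul]
    refine setIntegral_congr_fun measurableSet_Ioi fun r (hr : 0 < r) => ?_
    have hω : ‖(ω : EuclideanSpace ℝ (Fin n))‖ = 1 := by simp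
    have hfin : Module.finrank ℝ (EuclideanSpace ℝ (Fin n)) - 1 = 2 * l + 1 := by
      rw [finrank_euclideanSpace_fin]; omega
    simp only [hK]
    rw [norm_smul, hω, mul_one, Real.norm_of_nonneg hr.le, hfin, ← Complex.coe_smul, smul_smul,
      smul_smul]
    congr 1
    push_cast
    ring
  refine ⟨?_, ?_⟩
  · simpa only [hin] using integrable_polar_integral volume hint
  · rw [fourierPartialInversion_eq_integral_kernel R hF, integral_polar volume hint]
    simp only [hin]

theorem toSphere_real_univ_of_dim_even {n k : ℕ} (hk : 1 ≤ k) (hn : n = 2 * k) :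
    (volume : Measure (EuclideanSpace ℝ (Fin n))).toSphere.real Set.univ =
      2 * k * (Real.pi ^ k / k.factorial) := by
  have : Nontrivial (EuclideanSpace ℝ (Fin n)) := by
    have : Nonempty (Fin n) := ⟨⟨0, by omega⟩⟩
    infer_instance
  rw [Measure.toSphere_real_apply_univ, Measure.real,
    InnerProductSpace.volume_ball_of_dim_even (k := k) (by simpa using hn),
    finrank_euclideanSpace_fin, ENNReal.ofReal_one, one_pow, one_mul,
    ENNReal.toReal_ofReal (by positivity), hn]
  push_cast; ring

/-- The partial inversion error is controlled by an integral of `|P_0(R|y|)|` against any radial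
majorant of the directional derivatives. -/
theorem exists_fourierPartialInversion_bound [CompleteSpace X] {n l : ℕ} (hn : n = 2 * (l + 1)) :
    ∃ C : ℝ, 0 ≤ C ∧ ∀ (F : EuclideanSpace ℝ (Fin n) → X) (H : EuclideanSpace ℝ (Fin n) → ℝ)
      (x : EuclideanSpace ℝ (Fin n)), Integrable F → ContDiff ℝ (l + 1 : ℕ) F → Integrable H →
      (∀ w : EuclideanSpace ℝ (Fin n), ‖w‖ = 1 → ∀ j ≤ l + 1, ∀ r : ℝ, 0 < r →
        max 1 (r ^ l) * ‖iteratedFDeriv ℝ j F (x + r • w) (fun _ => w)‖ ≤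
          r ^ (2 * l + 1) * H (r • w)) → ∀ R, 0 < R →
      ‖fourierPartialInversion R F x - F x‖ ≤ C * ∫ y, ‖besselIntegral 0 (R * ‖y‖)‖ * H y := by
  have : Nontrivial (EuclideanSpace ℝ (Fin n)) := by
    have : Nonempty (Fin n) := ⟨⟨0, by omega⟩⟩
    infer_instance
  obtain ⟨C, hC0, hC⟩ := exists_besselRadialIntegral_bound (X := X) l
  refine ⟨‖dirichletConst (l + 1)‖ * C, by positivity, fun F H x hF hFk hH hFH R hR => ?_⟩
  obtain ⟨hI, hS⟩ := fourierPartialInversion_eq_besselRadialIntegral hn hF hR x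
  set σ := (volume : Measure (EuclideanSpace ℝ (Fin n))).toSphere
  have hfin : Module.finrank ℝ (EuclideanSpace ℝ (Fin n)) - 1 = 2 * l + 1 := by
    rw [finrank_euclideanSpace_fin]; omega
  -- F(x) is spread over the sphere so that the error can be estimated direction by direction.
  have hFx : F x = ∫ _ω : Metric.sphere (0 : EuclideanSpace ℝ (Fin n)) 1, dirichletConst (l + 1) •
      ((Real.pi * (2 * l + 1).factorial : ℝ) : ℂ) • F x ∂σ := by
    rw [integral_const, toSphere_real_univ_of_dim_even (by omega) hn, ← Complex.coe_smul, smul_smul,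
      smul_smul]
    have h1 := dirichletConst_mul_eq_one (k := l + 1) (by omega)
    rw [show 2 * (l + 1) - 1 = 2 * l + 1 by omega] at h1
    conv_lhs => rw [← one_smul ℂ (F x), ← h1]
    congr 1
    ring
  have hc := continuous_besselIntegral 0
  have hPH : Integrable fun y : EuclideanSpace ℝ (Fin n) => ‖besselIntegral 0 (R * ‖y‖)‖ * H y :=
    hH.bdd_mul (c := Real.pi) (Continuous.aestronglyMeasurable (by fun_prop))
      (Eventually.of_forall fun y => by rw [norm_norm]; exact norm_besselIntegral_le _ _)
  rw [hS]
  conv_lhs => rw [hFx]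
  rw [← integral_sub hI (integrable_const _), mul_assoc, integral_polar volume hPH,
    ← integral_const_mul, ← integral_const_mul]
  refine norm_integral_le_of_norm_le
    (((integrable_polar_integral volume hPH).const_mul C).const_mul _) ?_
  -- H is integrable along almost every ray only, which is enough under the sphere integral.
  filter_upwards [ae_integrableOn_polar volume hH] with ω hω
  have hω1 : ‖(ω : EuclideanSpace ℝ (Fin n))‖ = 1 := by simp
  rw [hfin] at hω ⊢
  simp only [smul_eq_mul] at hω ⊢
  rw [← smul_sub, norm_smul]
  refine mul_le_mul_of_nonneg_left ?_ (norm_nonneg _)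
  have hv : ContDiff ℝ (l + 1 : ℕ) fun r : ℝ => F (x + r • (ω : EuclideanSpace ℝ (Fin n))) := by
    fun_prop
  have := hC (fun r : ℝ => F (x + r • (ω : EuclideanSpace ℝ (Fin n))))
    (fun r => r ^ (2 * l + 1) * H (r • (ω : EuclideanSpace ℝ (Fin n)))) hv hω (fun j hj r hr => by
      rw [iteratedDeriv_comp_line hFk x _ hj]
      exact hFH _ hω1 j hj r hr) R hR
  rw [zero_smul, add_zero] at this
  refine this.trans_eq ?_
  congr 1
  refine setIntegral_congr_fun measurableSet_Ioi fun r (hr : 0 < r) => ?_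
  simp only [norm_smul, hω1, mul_one, Real.norm_of_nonneg hr.le]
  ring

theorem tendsto_integral_besselIntegral_mul {E : Type*} [NormedAddCommGroup E] [NormedSpace ℝ E]
    [MeasurableSpace E] [BorelSpace E] [FiniteDimensional ℝ E] [Nontrivial E] (μ : Measure E)
    [μ.IsAddHaarMeasure] {H : E → ℝ} (hH : Integrable H μ) :
    Tendsto (fun R : ℝ => ∫ y, ‖besselIntegral 0 (R * ‖y‖)‖ * H y ∂μ) atTop (nhds 0) := by
  have hc := continuous_besselIntegral 0
  have h := tendsto_integral_filter_of_dominated_convergence (μ := μ) (l := atTop)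
    (F := fun (R : ℝ) (y : E) => ‖besselIntegral 0 (R * ‖y‖)‖ * H y) (f := fun _ => 0)
    (fun y => Real.pi * ‖H y‖)
    (Eventually.of_forall fun R => (Continuous.aestronglyMeasurable (by fun_prop)).mul hH.1)
    (Eventually.of_forall fun R => Eventually.of_forall fun y => by
      rw [norm_mul, norm_norm]
      exact mul_le_mul_of_nonneg_right (norm_besselIntegral_le _ _) (norm_nonneg _))
    (hH.norm.const_mul _) (by
      filter_upwards [Measure.ae_ne μ (0 : E)] with y hy
      have h1 : Tendsto (fun R : ℝ => R * ‖y‖) atTop atTop :=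
        tendsto_id.atTop_mul_const (norm_pos_iff.2 hy)
      simpa using (tendsto_besselIntegral_zero.comp h1).norm.mul_const (H y))
  simpa using h

-- For r < δ the derivatives are bounded on the compact set K + closed δ-ball, and H may blow up
-- like r^{-(2l+1)} since the polar Jacobian cancels it. For r ≥ δ the weight r^l times the allowed
-- growth r^{l+1} is exactly that Jacobian, so a multiple of |g| suffices.
open scoped Pointwise in
theorem exists_integrable_majorant {n l : ℕ} (hn : n = 2 * (l + 1))
    {K : Set (EuclideanSpace ℝ (Fin n))} (hK : IsCompact K)
    {F : EuclideanSpace ℝ (Fin n) → X} (hFk : ContDiff ℝ (l + 1 : ℕ) F)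
    {g : EuclideanSpace ℝ (Fin n) → ℝ} {δ : ℝ} (hg : Integrable g) (hδ : 0 < δ)
    (hFg : ∀ y : EuclideanSpace ℝ (Fin n), δ ≤ ‖y‖ → ∀ α : Fin n → ℕ, ∑ i, α i ≤ l + 1 →
      ∀ x ∈ K, ‖multiPartialDeriv α F (x + y)‖ ≤ ‖y‖ ^ (l + 1) * g y) :
    ∃ H : EuclideanSpace ℝ (Fin n) → ℝ, Integrable H ∧
      ∀ x ∈ K, ∀ w : EuclideanSpace ℝ (Fin n), ‖w‖ = 1 → ∀ j ≤ l + 1, ∀ r : ℝ, 0 < r →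
        max 1 (r ^ l) * ‖iteratedFDeriv ℝ j F (x + r • w) (fun _ => w)‖ ≤
          r ^ (2 * l + 1) * H (r • w) := by
  have : Nontrivial (EuclideanSpace ℝ (Fin n)) := by
    have : Nonempty (Fin n) := ⟨⟨0, by omega⟩⟩
    infer_instance
  have hcomp : IsCompact (K + Metric.closedBall (0 : EuclideanSpace ℝ (Fin n)) δ) :=
    hK.add (isCompact_closedBall _ _)
  have hB : ∀ j : ℕ, ∃ B : ℝ, j ≤ l + 1 → ∀ z ∈ K + Metric.closedBall (0 : EuclideanSpace ℝ (Fin n)) δ,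
      ‖iteratedFDeriv ℝ j F z‖ ≤ B := by
    intro j
    by_cases hj : j ≤ l + 1
    · obtain ⟨B, hB⟩ := hcomp.exists_bound_of_continuousOn
        (hFk.continuous_iteratedFDeriv (by exact_mod_cast hj : (j : WithTop ℕ∞) ≤ (l + 1 : ℕ))).continuousOn
      exact ⟨B, fun _ => hB⟩
    · exact ⟨0, fun h => absurd h hj⟩
  choose B hB using hB
  set M : ℝ := max 1 (δ ^ l) * ∑ j ∈ Finset.range (l + 2), |B j| with hM
  set C : ℝ := (1 + (δ ^ l)⁻¹) * (n : ℝ) ^ (l + 1) with hC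
  have hn1 : (1 : ℝ) ≤ n := by
    have : 1 ≤ n := by omega
    exact_mod_cast this
  have hM0 : 0 ≤ M := by positivity
  have hC0 : 0 ≤ C := by positivity
  refine ⟨fun y => (Set.Iio δ).indicator (fun r => (r ^ (2 * l + 1))⁻¹ * M) ‖y‖ + C * |g y|, ?_, ?_⟩
  · refine Integrable.add ?_ (hg.abs.const_mul C)
    rw [integrable_fun_norm_addHaar volume
      (f := (Set.Iio δ).indicator (fun r => (r ^ (2 * l + 1))⁻¹ * M)), finrank_euclideanSpace_fin,
      show n - 1 = 2 * l + 1 by omega]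
    have hb : IntegrableOn (fun r : ℝ => (Set.Iio δ).indicator (fun _ => M) r) (Set.Ioi 0) := by
      rw [integrableOn_indicator_iff measurableSet_Iio, Set.inter_comm, Set.Ioi_inter_Iio]
      exact integrableOn_const (by simp)
    refine hb.congr_fun (fun r (hr : 0 < r) => ?_) measurableSet_Ioi
    by_cases h : r ∈ Set.Iio δ
    · simp only [Set.indicator_of_mem h, smul_eq_mul]
      field_simp
    · simp [Set.indicator_of_notMem h]
  · intro x hx w hw j hj r hr
    have hnorm : ‖r • w‖ = r := by rw [norm_smul, hw, mul_one, Real.norm_of_nonneg hr.le]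
    have hrp : 0 < r ^ (2 * l + 1) := by positivity
    simp only [hnorm]
    rcases lt_or_ge r δ with h | h
    · rw [Set.indicator_of_mem (show r ∈ Set.Iio δ from h), mul_add, ← mul_assoc,
        mul_inv_cancel₀ hrp.ne', one_mul]
      refine le_add_of_le_of_nonneg ?_ (by positivity)
      refine mul_le_mul ?_ ?_ (norm_nonneg _) (by positivity)
      · exact max_le_max le_rfl (pow_le_pow_left₀ hr.le h.le l)
      · refine ((iteratedFDeriv ℝ j F (x + r • w)).le_opNorm _).trans ?_
        rw [Finset.prod_const, hw, one_pow, mul_one]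
        refine (hB j hj _ (Set.add_mem_add hx (by simp [hnorm, h.le]))).trans ?_
        exact (le_abs_self _).trans (Finset.single_le_sum (f := fun j => |B j|)
          (fun _ _ => abs_nonneg _) (Finset.mem_range.2 (by omega)))
    · rw [Set.indicator_of_notMem (by simpa using h), zero_add]
      have h1 := norm_iteratedFDeriv_le_of_multiPartialDeriv (hFk.of_le (by exact_mod_cast hj))
        (x := x + r • w) hw (B := r ^ (l + 1) * |g (r • w)|) fun α hα => by
          have := hFg (r • w) (by rwa [hnorm]) α (by omega) x hx
          rw [hnorm] at this
          exact this.trans (by gcongr; exact le_abs_self _)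
      -- Away from the origin 1 is at most a constant multiple of r^l, which explains the factor 1 +
      -- δ^{-l} in `C`.
      have h2 : max 1 (r ^ l) ≤ (1 + (δ ^ l)⁻¹) * r ^ l := by
        have hd : δ ^ l ≤ r ^ l := pow_le_pow_left₀ hδ.le h l
        have hd' : 1 ≤ (δ ^ l)⁻¹ * r ^ l := by
          rw [inv_mul_eq_div, one_le_div (by positivity)]; exact hd
        have : 0 < r ^ l := by positivity
        rw [add_mul, one_mul]
        exact max_le (by linarith) (by linarith)
      have h3 : (n : ℝ) ^ j ≤ n ^ (l + 1) := pow_le_pow_right₀ hn1 hj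
      calc _ ≤ ((1 + (δ ^ l)⁻¹) * r ^ l) * (n ^ (l + 1) * (r ^ (l + 1) * |g (r • w)|)) := by
            refine mul_le_mul h2 (h1.trans ?_) (norm_nonneg _) (by positivity)
            gcongr
        _ = _ := by rw [hC]; ring

end Inversion

end

/-! ### Uniform convergence on K. -/

theorem mainTheorem5 {X : Type*} [NormedAddCommGroup X] [NormedSpace ℂ X] [CompleteSpace X]
    {n k : ℕ} (hk : 1 ≤ k) (hn : n = 2 * k)
    {K : Set (EuclideanSpace ℝ (Fin n))} (hK : IsCompact K)
    {F : EuclideanSpace ℝ (Fin n) → X} (hF : Integrable F) (hFk : ContDiff ℝ (k : ℕ∞) F)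
    (hg : ∃ (g : EuclideanSpace ℝ (Fin n) → ℝ) (δ : ℝ), Integrable g ∧ 0 < δ ∧
      ∀ y : EuclideanSpace ℝ (Fin n), δ ≤ ‖y‖ →
        ∀ α : Fin n → ℕ, ∑ i, α i ≤ k → ∀ x ∈ K,
          ‖y‖ ^ (-(n : ℤ) + (k : ℤ)) * ‖multiPartialDeriv α F (x + y)‖ ≤ g y) :
    TendstoUniformlyOn (fun (R : ℝ) (x : EuclideanSpace ℝ (Fin n)) =>
      fourierPartialInversion R F x) F atTop K := by
  obtain ⟨g, δ, hg, hδ, hFg⟩ := hg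
  obtain ⟨l, rfl⟩ : ∃ l, k = l + 1 := ⟨k - 1, by omega⟩
  have : Nontrivial (EuclideanSpace ℝ (Fin n)) := by
    have : Nonempty (Fin n) := ⟨⟨0, by omega⟩⟩
    infer_instance
  have hFk' : ContDiff ℝ (l + 1 : ℕ) F := by exact_mod_cast hFk
  obtain ⟨H, hH, hFH⟩ := exists_integrable_majorant hn hK hFk' hg hδ fun y hy α hα x hx => by
    have hy0 : 0 < ‖y‖ := hδ.trans_le hy
    have h := hFg y hy α hα x hx
    -- With n = 2k the exponent -n + k is -k, so the hypothesis permits growth |y|^k g(y).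
    rw [show -(n : ℤ) + ((l + 1 : ℕ) : ℤ) = -((l + 1 : ℕ) : ℤ) by rw [hn]; push_cast; ring,
      zpow_neg, zpow_natCast, inv_mul_le_iff₀ (by positivity)] at h
    exact h
  obtain ⟨C, hC0, hC⟩ := exists_fourierPartialInversion_bound (X := X) hn
  have hlim := (tendsto_integral_besselIntegral_mul volume hH).const_mul C
  rw [mul_zero] at hlim
  rw [Metric.tendstoUniformlyOn_iff]
  intro ε hε
  filter_upwards [hlim.eventually_lt_const hε, eventually_gt_atTop 0] with R hR hR0 x hx
  rw [dist_comm, dist_eq_norm]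
  exact (hC F H x hF hFk' hH (hFH x hx) R hR0).trans_lt hR
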